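/- Let $d\ge 1$ and let $P_d=\{x\in\mathbf R^d : x_i\ge 0,\ \sum_i x_i=1\}$ be the set of $d$-dimensional probability vectors. Vectors of finite dimension are identified with the finitely supported sequences obtained by appending zeros, and $\|\cdot\|_1$ denotes the $\ell_1$-norm. For $x \in P_d$ and $p\in\mathbf R$ put $N_p(x)=\sum_{i:\,x_i>0}x_i^p$. For finite-dimensional probability vectors $u,v$ (brought to a common dimension $m$ by appending zeros) write $u\prec v$ ($u$ is majorized by $v$) if $\sum_{i=1}^k u_i^\downarrow\le\sum_{i=1}^k v_i^\downarrow$ for all $1\le k\le m$, where $u^\downarrow$ is the decreasing rearrangement of $u$. For $u\in P_e$ and $k\ge 1$ let $u^{\otimes k}\in P_{e^k}$ be the $k$-fold tensor power, i.e. the vector with coordinates $u_{i_1}\cdots u_{i_k}$, $1\le i_1,\dots,i_k\le e$. Let $x,y\in P_d$ satisfy $N_p(x)\le N_p(y)$ for all real $p\ge 1$. Then there exists a sequence $(x_n)_{n}$ of probability vectors of finite, but possibly varying, dimensions $e_n$, $x_n\in P_{e_n}$, such that for every $n$ there is an integer $k\ge 1$ with $x_n^{\otimes k}\prec y^{\otimes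 k}$, and $\|x_n-x\|_1\to 0$ as $n\to\infty$. -/

import Mathlib

open Filter Topology

noncomputable section

namespace Catalysis

/-- The set `P_d` of `d`-dimensional probability vectors. -/
def P (d : ℕ) : Set (Fin d → ℝ) :=
  stdSimplex ℝ (Fin d)

/-- The decreasing rearrangement of a finite family of reals: its values (with multiplicity)
listed in decreasing order, followed by zeros. -/
def decr {ι : Type*} [Fintype ι] (x : ι → ℝ) (i : ℕ) : ℝ :=
  ((Finset.univ.val.map x).sort (· ≥ ·)).getD i 0

/-- Majorization `x ≺ y` of finite vectors with nonnegative entries; vectors of different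
dimensions are compared after appending zeros. -/
def Majorized {ι κ : Type*} [Fintype ι] [Fintype κ] (x : ι → ℝ) (y : κ → ℝ) : Prop :=
  ∀ k : ℕ, ∑ i ∈ Finset.range k, decr x i ≤ ∑ i ∈ Finset.range k, decr y i

/-- The tensor power `x^{⊗n}`, with coordinates indexed by multi-indices. -/
def tensorPow {d : ℕ} (x : Fin d → ℝ) (n : ℕ) : (Fin n → Fin d) → ℝ :=
  fun a => ∏ j, x (a j)

/-- Multiple-copy majorization `x ≺_M y`. -/
def MajorizedM {e d : ℕ} (x : Fin e → ℝ) (y : Fin d → ℝ) : Prop :=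
  ∃ n : ℕ, 1 ≤ n ∧ Majorized (tensorPow x n) (tensorPow y n)

/-- The set `M_e(y)` of `e`-dimensional probability vectors `x` with `x ≺_M y`. -/
def M (e : ℕ) {d : ℕ} (y : Fin d → ℝ) : Set (Fin e → ℝ) :=
  {x | x ∈ P e ∧ MajorizedM x y}

/-- The space `ℓ¹` of real sequences, with the norm `∑ i, |x i|`. -/
abbrev L1 : Type := lp (fun _ : ℕ => ℝ) 1

/-- A `d`-dimensional vector followed by zeros, as an element of `ℓ¹`. -/
def pad {d : ℕ} (x : Fin d → ℝ) : L1 :=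
  ⟨fun i => if h : i < d then x ⟨i, h⟩ else 0,
    (memℓp_zero ((Set.finite_lt_nat d).subset fun i hi => by
      by_contra h
      exact hi (dif_neg h))).of_exponent_ge zero_le_one⟩

/-- The set `M_{<∞}(y)`, the union of the sets `M_e(y)` over all dimensions `e`. -/
def MFin {d : ℕ} (y : Fin d → ℝ) : Set L1 :=
  ⋃ e : ℕ, pad '' M e y

/-- `N_p(x)`, the sum of the `p`-th powers of the nonzero coordinates of `x`. -/
def N {d : ℕ} (p : ℝ) (x : Fin d → ℝ) : ℝ :=
  ∑ i with 0 < x i, x i ^ p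

end Catalysis

end

/-!
For nonnegative vectors, `u ≺ v` follows once `∑ i, (u i - t)⁺ ≤ ∑ i, (v i - t)⁺` for every level
`t ≥ 0`. For `x^{⊗n}` the Chernoff bound controls the left side by `(∑ i, x i ^ p) ^ n` for any
`p ≥ 1`; for `y^{⊗n}` the matching lower bound, up to a factor `exp (n η)`, is Cramér's theorem:
weight the multi-indices by `y^p`, with `p` chosen so that the typical coordinate of `y^{⊗n}` sits
just above the level, and use Chebyshev's inequality. Replacing `x` by `(1 - ε) x` gains an
exponentially small factor that absorbs this loss. The missing mass `ε` is refilled by at least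
`d ^ n` equal coordinates; they affect only levels `t` below their common value, where convexity in
`t` of the excess reduces the comparison to the two endpoints.
-/

namespace Catalysis

open Finset

section Majorization

variable {ι κ : Type*} [Fintype ι] [Fintype κ]

lemma decr_eq_zero_of_card_le (x : ι → ℝ) {k : ℕ} (hk : Fintype.card ι ≤ k) : decr x k = 0 :=
  List.getD_eq_default _ _ (by simpa using hk)

lemma antitone_decr {x : ι → ℝ} (hx : ∀ i, 0 ≤ x i) : Antitone (decr x) := by
  intro j k hjk
  have hnonneg : ∀ v ∈ (univ.val.map x).sort (· ≥ ·), 0 ≤ v := by simpa using hx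
  have hsorted := List.pairwise_iff_getElem.1 (Multiset.pairwise_sort (univ.val.map x) (· ≥ ·))
  simp only [decr, List.getD_eq_getElem?_getD]
  grind

lemma decr_nonneg {x : ι → ℝ} (hx : ∀ i, 0 ≤ x i) (k : ℕ) : 0 ≤ decr x k := by
  rw [← decr_eq_zero_of_card_le x (le_max_right k _)]
  exact antitone_decr hx (le_max_left _ _)

lemma sum_comp_eq_sum_range_decr (x : ι → ℝ) {g : ℝ → ℝ} (hg : g 0 = 0) {m : ℕ}
    (hm : Fintype.card ι ≤ m) : ∑ i, g (x i) = ∑ k ∈ range m, g (decr x k) := by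
  set l := (univ.val.map x).sort (· ≥ ·) with hl
  have hlen : l.length = Fintype.card ι := by simp [hl]
  calc ∑ i, g (x i) = (l.map g).sum := by
        rw [← Multiset.sum_coe, ← Multiset.map_coe, Multiset.sort_eq, Multiset.map_map]
        rfl
    _ = ∑ k ∈ range (Fintype.card ι), g (decr x k) := by
        rw [← hlen, Finset.sum_range, ← Fin.sum_univ_fun_getElem]
        simp [decr, ← hl]
    _ = ∑ k ∈ range m, g (decr x k) :=
        sum_subset (range_mono hm) fun k _ hk => by
          rw [decr_eq_zero_of_card_le x (by simpa using hk), hg]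

/-- The total excess of the coordinates of `x` over the level `t`. It is the Legendre-type dual of
the partial sums of `decr x`, so that comparing excesses at all levels amounts to majorization. -/
def excess (x : ι → ℝ) (t : ℝ) : ℝ :=
  ∑ i, (x i - t)⁺

lemma excess_eq_sum_range_decr (x : ι → ℝ) {t : ℝ} (ht : 0 ≤ t) {m : ℕ}
    (hm : Fintype.card ι ≤ m) : excess x t = ∑ k ∈ range m, (decr x k - t)⁺ :=
  sum_comp_eq_sum_range_decr x (g := fun v => (v - t)⁺) (by simpa using ht) hm

lemma sum_range_decr_le (x : ι → ℝ) {t : ℝ} (ht : 0 ≤ t) (k : ℕ) :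
    ∑ j ∈ range k, decr x j ≤ k * t + excess x t := by
  calc ∑ j ∈ range k, decr x j ≤ ∑ j ∈ range k, (t + (decr x j - t)⁺) :=
        sum_le_sum fun j _ => by linarith [le_posPart (decr x j - t)]
    _ = k * t + ∑ j ∈ range k, (decr x j - t)⁺ := by simp [sum_add_distrib]
    _ ≤ k * t + ∑ j ∈ range (max k (Fintype.card ι)), (decr x j - t)⁺ := by
        gcongr
        exact le_max_left _ _
    _ = k * t + excess x t := by rw [excess_eq_sum_range_decr x ht (le_max_right k _)]

lemma sum_range_decr_eq {x : ι → ℝ} (hx : ∀ i, 0 ≤ x i) (k : ℕ) :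
    ∑ j ∈ range k, decr x j = k * decr x k + excess x (decr x k) := by
  have hanti := antitone_decr hx
  have hexcess : excess x (decr x k) = ∑ j ∈ range k, (decr x j - decr x k) := by
    rw [excess_eq_sum_range_decr x (decr_nonneg hx k) (le_max_right k _),
      ← sum_subset (range_mono (le_max_left k _)) fun j _ hj =>
        posPart_eq_zero.2 (sub_nonpos.2 (hanti (by simpa using hj)))]
    exact sum_congr rfl fun j hj =>
      posPart_eq_self.2 (sub_nonneg.2 (hanti (mem_range.1 hj).le))
  simp [hexcess]

theorem majorized_of_excess_le {x : ι → ℝ} {y : κ → ℝ} (hy : ∀ i, 0 ≤ y i)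
    (h : ∀ t, 0 ≤ t → excess x t ≤ excess y t) : Majorized x y := by
  intro k
  have hnonneg : 0 ≤ decr y k := decr_nonneg hy k
  calc ∑ j ∈ range k, decr x j ≤ k * decr y k + excess x (decr y k) :=
        sum_range_decr_le x hnonneg k
    _ ≤ k * decr y k + excess y (decr y k) := by gcongr; exact h _ hnonneg
    _ = ∑ j ∈ range k, decr y j := (sum_range_decr_eq hy k).symm

lemma convexOn_excess (x : ι → ℝ) : ConvexOn ℝ Set.univ (excess x) := by
  refine ⟨convex_univ, fun s _ t _ a b ha hb hab => ?_⟩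
  simp only [excess, smul_eq_mul, mul_sum, ← sum_add_distrib]
  refine sum_le_sum fun i _ => sup_le ?_ (by positivity)
  calc x i - (a * s + b * t) = a * (x i - s) + b * (x i - t) := by linear_combination -(x i) * hab
    _ ≤ a * (x i - s)⁺ + b * (x i - t)⁺ := by gcongr <;> exact le_posPart _

lemma excess_le_sum {x : ι → ℝ} (hx : ∀ i, 0 ≤ x i) {t : ℝ} (ht : 0 ≤ t) :
    excess x t ≤ ∑ i, x i :=
  sum_le_sum fun i _ => sup_le (by linarith) (hx i)

lemma sum_sub_card_mul_le_excess (x : ι → ℝ) (t : ℝ) :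
    ∑ i, x i - Fintype.card ι * t ≤ excess x t := by
  calc ∑ i, x i - Fintype.card ι * t = ∑ i, (x i - t) := by simp [sum_sub_distrib]
    _ ≤ excess x t := sum_le_sum fun i _ => le_posPart (x i - t)

end Majorization

section Chebyshev

open MeasureTheory ProbabilityTheory

variable {ι κ : Type*} [Fintype ι] [Fintype κ] [DecidableEq κ]

theorem one_sub_le_sum_prod_of_abs_le {w f : ι → ℝ} (hw : w ∈ stdSimplex ℝ ι) {L : ℝ}
    (hf : ∀ i, |f i| ≤ L) {r : ℝ} (hr : 0 < r) :
    1 - Fintype.card κ * L ^ 2 / r ^ 2 ≤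
      ∑ a : κ → ι with |∑ j, f (a j) - Fintype.card κ * ∑ i, w i * f i| < r,
        ∏ j, w (a j) := by
  let _ : MeasurableSpace ι := ⊤
  let ν : PMF ι := PMF.ofFintype (fun i => ENNReal.ofReal (w i)) (by
    rw [← ENNReal.ofReal_sum_of_nonneg fun i _ => hw.1 i, hw.2, ENNReal.ofReal_one])
  let μ : Measure (κ → ι) := Measure.pi fun _ => ν.toMeasure
  let S : (κ → ι) → ℝ := ∑ j, fun a => f (a j)
  have hS : MemLp S 2 μ := .of_discrete
  have hmean : μ[S] = Fintype.card κ * ∑ i, w i * f i := by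
    have hfint : ∫ i, f i ∂ν.toMeasure = ∑ i, w i * f i := by
      simp [PMF.integral_eq_sum, ν, ENNReal.toReal_ofReal, hw.1]
    simp only [S, Finset.sum_apply]
    rw [integral_finsetSum _ fun j _ => .of_finite]
    simp [μ, integral_comp_eval (μ := fun _ : κ => ν.toMeasure) (f := f) .of_discrete, hfint]
  have hvar : Var[S; μ] ≤ Fintype.card κ * L ^ 2 := by
    have hone : Var[f; ν.toMeasure] ≤ L ^ 2 := by
      simpa using variance_le_sq_of_bounded (a := -L) (b := L)
        (.of_forall fun i => abs_le.1 (hf i)) (Measurable.of_discrete (f := f)).aemeasurable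
    rw [variance_sum_pi fun _ => .of_discrete]
    simpa using sum_le_sum fun (j : κ) (_ : j ∈ univ) => hone
  have hdeviation : μ.real {a | r ≤ |S a - μ[S]|} ≤ Fintype.card κ * L ^ 2 / r ^ 2 := by
    refine ENNReal.toReal_le_of_le_ofReal (by positivity)
      ((meas_ge_le_variance_div_sq hS hr).trans (ENNReal.ofReal_le_ofReal ?_))
    gcongr
  have hsingleton (a : κ → ι) : ∏ j, w (a j) = μ.real {a} := by
    have hν (i : ι) : ν.toMeasure {i} = ENNReal.ofReal (w i) :=
      ν.toMeasure_apply_singleton i .of_discrete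
    simp [μ, Measure.real, hν, ENNReal.toReal_prod, ENNReal.toReal_ofReal, hw.1]
  calc 1 - Fintype.card κ * L ^ 2 / r ^ 2 ≤ 1 - μ.real {a | r ≤ |S a - μ[S]|} := by gcongr
    _ = μ.real {a | |S a - μ[S]| < r} := by
        rw [← probReal_compl_eq_one_sub .of_discrete]
        simp only [Set.compl_ofPred, not_le]
    _ = _ := by
        simp only [hsingleton, sum_measureReal_singleton, coe_filter, mem_univ, true_and, hmean]
        simp [S]

end Chebyshev

section Tilting

variable {ι : Type*} [Fintype ι] {y : ι → ℝ}

/-- The probability weights proportional to `y i ^ p`. Tilting `y` in this way moves the typical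
size of the coordinates of its tensor powers. -/
noncomputable def tilt (y : ι → ℝ) (p : ℝ) (i : ι) : ℝ :=
  y i ^ p / ∑ j, y j ^ p

/-- The mean of `log y` under the tilted weights, that is, the derivative of `log (∑ i, y i ^ p)`
with respect to `p`. -/
noncomputable def tiltedMean (y : ι → ℝ) (p : ℝ) : ℝ :=
  ∑ i, tilt y p i * Real.log (y i)

lemma sum_rpow_pos (hy : ∀ i, 0 ≤ y i) {i₀ : ι} (hi₀ : 0 < y i₀) (p : ℝ) : 0 < ∑ i, y i ^ p :=
  sum_pos' (fun i _ => Real.rpow_nonneg (hy i) p) ⟨i₀, mem_univ _, Real.rpow_pos_of_pos hi₀ p⟩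

lemma tilt_mem_stdSimplex (hy : ∀ i, 0 ≤ y i) {i₀ : ι} (hi₀ : 0 < y i₀) (p : ℝ) :
    tilt y p ∈ stdSimplex ℝ ι := by
  have hsum := sum_rpow_pos hy hi₀ p
  refine ⟨fun i => div_nonneg (Real.rpow_nonneg (hy i) p) hsum.le, ?_⟩
  simp only [tilt, ← sum_div, div_self hsum.ne']

lemma tilt_le_div_rpow (hy : ∀ i, 0 ≤ y i) (i : ι) {j : ι} (hj : 0 < y j) (p : ℝ) :
    tilt y p i ≤ (y i / y j) ^ p := by
  rw [tilt, Real.div_rpow (hy i) hj.le]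
  exact div_le_div_of_nonneg_left (Real.rpow_nonneg (hy i) p) (Real.rpow_pos_of_pos hj p)
    (single_le_sum (f := fun k => y k ^ p) (fun k _ => Real.rpow_nonneg (hy k) p) (mem_univ j))

lemma tendsto_tilt_atTop_zero (hy : ∀ i, 0 ≤ y i) {i j : ι} (hij : y i < y j) :
    Tendsto (fun p => tilt y p i) atTop (𝓝 0) := by
  have hj : 0 < y j := (hy i).trans_lt hij
  have hratio : Tendsto (fun p : ℝ => (y i / y j) ^ p) atTop (𝓝 0) :=
    tendsto_rpow_atTop_of_base_lt_one _ (by linarith [div_nonneg (hy i) hj.le])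
      ((div_lt_one hj).2 hij)
  exact squeeze_zero (fun p => (tilt_mem_stdSimplex hy hj p).1 i)
    (fun p => tilt_le_div_rpow hy i hj p) hratio

lemma tendsto_tiltedMean_atTop (hy : ∀ i, 0 ≤ y i) {i₀ : ι} (hi₀ : 0 < y i₀)
    (hmax : ∀ i, y i ≤ y i₀) : Tendsto (tiltedMean y) atTop (𝓝 (Real.log (y i₀))) := by
  have hcentered (p : ℝ) : tiltedMean y p =
      ∑ i, tilt y p i * (Real.log (y i) - Real.log (y i₀)) + Real.log (y i₀) := by
    simp only [mul_sub, sum_sub_distrib, ← sum_mul, (tilt_mem_stdSimplex hy hi₀ p).2, tiltedMean]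
    ring
  have hterm (i : ι) : Tendsto (fun p => tilt y p i * (Real.log (y i) - Real.log (y i₀)))
      atTop (𝓝 0) := by
    rcases (hmax i).eq_or_lt with heq | hlt
    · simp [heq]
    · simpa using (tendsto_tilt_atTop_zero hy hlt).mul_const (Real.log (y i) - Real.log (y i₀))
  simpa [← hcentered] using
    (tendsto_finsetSum univ fun i _ => hterm i).add_const (Real.log (y i₀))

lemma continuousOn_tiltedMean (hy : ∀ i, 0 ≤ y i) {i₀ : ι} (hi₀ : 0 < y i₀) :
    ContinuousOn (tiltedMean y) (Set.Ioi 0) := by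
  have hpow (i : ι) : ContinuousOn (fun p : ℝ => y i ^ p) (Set.Ioi 0) := fun p hp =>
    (Real.continuousAt_const_rpow' (ne_of_gt hp)).continuousWithinAt
  exact continuousOn_finsetSum _ fun i _ => ((hpow i).div
    (continuousOn_finsetSum _ fun j _ => hpow j) fun p _ => (sum_rpow_pos hy hi₀ p).ne').mul
    continuousOn_const

lemma exists_le_tiltedMean (hy : ∀ i, 0 ≤ y i) {i₀ : ι} (hi₀ : 0 < y i₀) {c : ℝ}
    (hc : c < Real.log (y i₀)) :
    ∃ p, 1 ≤ p ∧ c ≤ tiltedMean y p ∧ (p = 1 ∨ tiltedMean y p = c) := by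
  have : Nonempty ι := ⟨i₀⟩
  obtain ⟨k, hmax⟩ := Finite.exists_max y
  have hk : 0 < y k := hi₀.trans_le (hmax i₀)
  have hck : c < Real.log (y k) := hc.trans_le (Real.log_le_log hi₀ (hmax i₀))
  rcases le_total c (tiltedMean y 1) with hle | hge
  · exact ⟨1, le_rfl, hle, .inl rfl⟩
  obtain ⟨b, hcb, hb⟩ := (((tendsto_tiltedMean_atTop hy hk hmax).eventually_const_lt hck).and
    (eventually_ge_atTop 1)).exists
  have hcont : ContinuousOn (tiltedMean y) (Set.Icc 1 b) :=
    (continuousOn_tiltedMean hy hk).mono fun p hp => zero_lt_one.trans_le hp.1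
  obtain ⟨p, hp, hpc⟩ := intermediate_value_Icc hb hcont ⟨hge, hcb.le⟩
  exact ⟨p, hp.1, hpc.ge, .inr hpc⟩

end Tilting

section PowerSums

lemma le_of_forall_sum_rpow_le {ι κ : Type*} [Fintype ι] [Fintype κ] {x : ι → ℝ} {y : κ → ℝ}
    (hx : ∀ i, 0 ≤ x i) (hy : ∀ i, 0 ≤ y i)
    (hpow : ∀ p : ℝ, 1 ≤ p → ∑ i, x i ^ p ≤ ∑ i, y i ^ p) {b : ℝ} (hb : 0 < b)
    (hyb : ∀ i, y i ≤ b) (i : ι) : x i ≤ b := by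
  by_contra! hbx
  obtain ⟨k, hk⟩ := pow_unbounded_of_one_lt (Fintype.card κ : ℝ) ((one_lt_div hb).2 hbx)
  have hle : x i ^ (k + 1) ≤ Fintype.card κ * b ^ (k + 1) := by
    calc x i ^ (k + 1) ≤ ∑ i, x i ^ (k + 1) :=
          single_le_sum (f := fun i => x i ^ (k + 1)) (fun j _ => pow_nonneg (hx j) _) (mem_univ i)
      _ ≤ ∑ i, y i ^ (k + 1) := by exact_mod_cast hpow ((k + 1 : ℕ) : ℝ) (by simp)
      _ ≤ ∑ _i : κ, b ^ (k + 1) := by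
          gcongr with j
          exacts [hy j, hyb j]
      _ = Fintype.card κ * b ^ (k + 1) := by simp
  have hlt : (Fintype.card κ : ℝ) < (x i / b) ^ (k + 1) :=
    hk.trans_le (pow_le_pow_right₀ ((one_lt_div hb).2 hbx).le k.le_succ)
  rw [div_pow, lt_div_iff₀ (by positivity)] at hlt
  exact hle.not_gt hlt

lemma N_eq_sum_rpow {d : ℕ} {x : Fin d → ℝ} (hx : ∀ i, 0 ≤ x i) {p : ℝ} (hp : p ≠ 0) :
    N p x = ∑ i, x i ^ p :=
  sum_filter_of_ne fun i _ hi => (hx i).lt_of_ne' fun h => hi (by rw [h, Real.zero_rpow hp])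

end PowerSums

section ExcessBounds

variable {ι κ : Type*} [Fintype ι] [Fintype κ]

lemma excess_eq_zero_of_le {x : ι → ℝ} {t : ℝ} (hx : ∀ i, x i ≤ t) : excess x t = 0 :=
  sum_eq_zero fun i _ => posPart_eq_zero.2 (sub_nonpos.2 (hx i))

lemma excess_nonneg (x : ι → ℝ) (t : ℝ) : 0 ≤ excess x t :=
  sum_nonneg fun i _ => posPart_nonneg (x i - t)

lemma excess_le_sum_rpow_mul {x : ι → ℝ} (hx : ∀ i, 0 ≤ x i) {p t : ℝ} (hp : 1 ≤ p)
    (ht : 0 < t) : excess x t ≤ (∑ i, x i ^ p) * t ^ (1 - p) := by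
  rw [excess, sum_mul]
  refine sum_le_sum fun i _ => sup_le ?_
    (mul_nonneg (Real.rpow_nonneg (hx i) p) (Real.rpow_nonneg ht.le _))
  rcases le_or_gt (x i) t with hle | hgt
  · exact (sub_nonpos.2 hle).trans
      (mul_nonneg (Real.rpow_nonneg (hx i) p) (Real.rpow_nonneg ht.le _))
  calc x i - t ≤ x i ^ p * x i ^ (1 - p) := by
        rw [← Real.rpow_add (ht.trans hgt), add_sub_cancel, Real.rpow_one]
        linarith
    _ ≤ x i ^ p * t ^ (1 - p) := by
        gcongr ?_ * ?_
        · exact Real.rpow_nonneg (hx i) p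
        · exact Real.rpow_le_rpow_of_nonpos ht hgt.le (by linarith)

lemma mul_sum_rpow_le_excess {x : ι → ℝ} {s : Finset ι} {p t b : ℝ} (hp : 1 ≤ p) (ht : 0 < t)
    (hs : ∀ i ∈ s, x i ≠ 0 → 2 * t ≤ x i ∧ x i ≤ b) :
    1 / 2 * b ^ (1 - p) * ∑ i ∈ s, x i ^ p ≤ excess x t := by
  have hterm (i : ι) (hi : i ∈ s) : 1 / 2 * b ^ (1 - p) * x i ^ p ≤ (x i - t)⁺ := by
    rcases eq_or_ne (x i) 0 with hzero | hne
    · simp [hzero, Real.zero_rpow (zero_lt_one.trans_le hp).ne']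
    obtain ⟨hlow, hhigh⟩ := hs i hi hne
    have hpos : 0 < x i := by linarith
    calc 1 / 2 * b ^ (1 - p) * x i ^ p ≤ 1 / 2 * x i ^ (1 - p) * x i ^ p := by
          gcongr ?_ * ?_ * ?_
          exact Real.rpow_le_rpow_of_nonpos hpos hhigh (by linarith)
      _ = x i / 2 := by
          rw [mul_assoc, ← Real.rpow_add hpos, sub_add_cancel, Real.rpow_one]
          ring
      _ ≤ x i - t := by linarith
      _ ≤ (x i - t)⁺ := le_posPart _
  rw [mul_sum]
  exact (sum_le_sum hterm).trans
    (sum_le_univ_sum_of_nonneg fun i => posPart_nonneg (x i - t))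

lemma excess_le_excess_of_le_of_excess_le {x : ι → ℝ} {y : κ → ℝ} (hx : ∀ i, 0 ≤ x i)
    (hsum : ∑ i, x i = ∑ i, y i) {s : ℝ} (hs : 0 < s)
    (hxs : excess x s ≤ ∑ i, y i - Fintype.card κ * s) {t : ℝ} (ht : 0 ≤ t) (hts : t ≤ s) :
    excess x t ≤ excess y t := by
  set θ := t / s
  have hθ0 : 0 ≤ θ := by positivity
  have hθ1 : θ ≤ 1 := (div_le_one hs).2 hts
  have hθs : θ * s = t := div_mul_cancel₀ t hs.ne'
  have hconv := (convexOn_excess x).2 (Set.mem_univ 0) (Set.mem_univ s) (sub_nonneg.2 hθ1) hθ0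
    (sub_add_cancel 1 θ)
  simp only [smul_eq_mul, mul_zero, zero_add, hθs] at hconv
  calc excess x t ≤ (1 - θ) * excess x 0 + θ * excess x s := hconv
    _ ≤ (1 - θ) * ∑ i, y i + θ * (∑ i, y i - Fintype.card κ * s) := by
        rw [← hsum] at hxs ⊢
        have hx0 := excess_le_sum hx le_rfl
        have : 0 ≤ 1 - θ := sub_nonneg.2 hθ1
        gcongr
    _ = ∑ i, y i - Fintype.card κ * t := by rw [← hθs]; ring
    _ ≤ excess y t := sum_sub_card_mul_le_excess y t

end ExcessBounds

section TensorPow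

variable {d : ℕ} {x : Fin d → ℝ}

lemma tensorPow_nonneg (hx : ∀ i, 0 ≤ x i) (n : ℕ) (a : Fin n → Fin d) : 0 ≤ tensorPow x n a :=
  prod_nonneg fun j _ => hx (a j)

lemma tensorPow_le_pow (hx : ∀ i, 0 ≤ x i) {b : ℝ} (hb : ∀ i, x i ≤ b) (n : ℕ)
    (a : Fin n → Fin d) : tensorPow x n a ≤ b ^ n := by
  simpa [tensorPow] using prod_le_prod (fun j (_ : j ∈ univ) => hx (a j)) fun j _ => hb (a j)

lemma tensorPow_rpow (hx : ∀ i, 0 ≤ x i) (n : ℕ) (a : Fin n → Fin d) (p : ℝ) :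
    tensorPow x n a ^ p = ∏ j, x (a j) ^ p :=
  (Real.finsetProd_rpow _ _ (fun j _ => hx (a j)) p).symm

lemma sum_tensorPow (x : Fin d → ℝ) (n : ℕ) : ∑ a, tensorPow x n a = (∑ i, x i) ^ n :=
  (Fintype.sum_pow x n).symm

lemma sum_tensorPow_rpow (hx : ∀ i, 0 ≤ x i) (n : ℕ) (p : ℝ) :
    ∑ a, tensorPow x n a ^ p = (∑ i, x i ^ p) ^ n := by
  simp only [tensorPow_rpow hx, Fintype.sum_pow]

lemma prod_tilt (hx : ∀ i, 0 ≤ x i) (p : ℝ) (n : ℕ) (a : Fin n → Fin d) :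
    ∏ j, tilt x p (a j) = tensorPow x n a ^ p / (∑ i, x i ^ p) ^ n := by
  simp [tilt, prod_div_distrib, tensorPow_rpow hx]

lemma log_tensorPow {n : ℕ} {a : Fin n → Fin d} (ha : tensorPow x n a ≠ 0) :
    Real.log (tensorPow x n a) = ∑ j, Real.log (x (a j)) :=
  Real.log_prod fun j hj => prod_ne_zero_iff.1 ha j hj

end TensorPow

section LowerBound

variable {d : ℕ} {y : Fin d → ℝ}

lemma half_mul_pow_le_sum_typical (hy : ∀ i, 0 ≤ y i) {i₀ : Fin d} (hi₀ : 0 < y i₀) {L : ℝ}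
    (hL : ∀ i, |Real.log (y i)| ≤ L) {n : ℕ} (hn : 0 < n) {δ : ℝ} (hδ : 0 < δ)
    (hnδ : 2 * L ^ 2 ≤ n * δ ^ 2) (p : ℝ) :
    1 / 2 * (∑ i, y i ^ p) ^ n ≤
      ∑ a : Fin n → Fin d with |∑ j, Real.log (y (a j)) - n * tiltedMean y p| < n * δ,
        tensorPow y n a ^ p := by
  have hn' : (0 : ℝ) < n := by exact_mod_cast hn
  have htypical := one_sub_le_sum_prod_of_abs_le (κ := Fin n) (tilt_mem_stdSimplex hy hi₀ p) hL
    (mul_pos hn' hδ)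
  have hhalf : n * L ^ 2 / (n * δ) ^ 2 ≤ 1 / 2 := by
    rw [div_le_iff₀ (by positivity)]
    nlinarith
  simp only [prod_tilt hy, ← sum_div, Fintype.card_fin, ← tiltedMean.eq_def] at htypical
  rw [← le_div_iff₀ (pow_pos (sum_rpow_pos hy hi₀ p) n)]
  linarith

lemma le_excess_tensorPow_of_two_mul_le (hy : ∀ i, 0 ≤ y i) {i₀ : Fin d} (hi₀ : 0 < y i₀)
    {L : ℝ} (hL : ∀ i, |Real.log (y i)| ≤ L) {n : ℕ} (hn : 0 < n) {δ : ℝ} (hδ : 0 < δ)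
    (hnδ : 2 * L ^ 2 ≤ n * δ ^ 2) {p t : ℝ} (hp : 1 ≤ p) (ht : 0 < t)
    (hle : 2 * t ≤ Real.exp (n * (tiltedMean y p - δ))) :
    1 / 4 * (∑ i, y i ^ p) ^ n * Real.exp (n * ((1 - p) * (tiltedMean y p + δ))) ≤
      excess (tensorPow y n) t := by
  set m := tiltedMean y p
  set s := univ.filter fun a : Fin n → Fin d => |∑ j, Real.log (y (a j)) - n * m| < n * δ
  have hbounds : ∀ a ∈ s, tensorPow y n a ≠ 0 →
      2 * t ≤ tensorPow y n a ∧ tensorPow y n a ≤ Real.exp (n * (m + δ)) := by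
    intro a ha hne
    have hpos := (tensorPow_nonneg hy n a).lt_of_ne' hne
    obtain ⟨hlow, hhigh⟩ := abs_lt.1 (mem_filter.1 ha).2
    rw [← log_tensorPow hne] at hlow hhigh
    exact ⟨hle.trans ((Real.le_log_iff_exp_le hpos).1 (by linarith)),
      (Real.log_le_iff_le_exp hpos).1 (by linarith)⟩
  calc 1 / 4 * (∑ i, y i ^ p) ^ n * Real.exp (n * ((1 - p) * (m + δ)))
      = 1 / 2 * Real.exp (n * (m + δ)) ^ (1 - p) * (1 / 2 * (∑ i, y i ^ p) ^ n) := by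
        rw [← Real.exp_mul]
        ring_nf
    _ ≤ 1 / 2 * Real.exp (n * (m + δ)) ^ (1 - p) * ∑ a ∈ s, tensorPow y n a ^ p := by
        gcongr
        exact half_mul_pow_le_sum_typical hy hi₀ hL hn hδ hnδ p
    _ ≤ excess (tensorPow y n) t := mul_sum_rpow_le_excess hp ht hbounds

theorem eventually_exists_le_excess_tensorPow (hy : ∀ i, 0 ≤ y i) {η : ℝ} (hη : 0 < η) :
    ∀ᶠ n : ℕ in atTop, ∀ τ : ℝ, (∃ i, Real.exp (τ + η) < y i) → ∃ p : ℝ, 1 ≤ p ∧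
      1 / 4 * (∑ i, y i ^ p) ^ n * Real.exp (n * ((1 - p) * (τ + η))) ≤
        excess (tensorPow y n) (Real.exp (n * τ)) := by
  obtain ⟨L, hL⟩ := (Set.finite_range fun i => |Real.log (y i)|).bddAbove
  rw [mem_upperBounds, Set.forall_mem_range] at hL
  set δ := η / 3 with hδη
  have hδ : 0 < δ := by positivity
  have hlarge (K : ℝ) {c : ℝ} (hc : 0 < c) : ∀ᶠ n : ℕ in atTop, K ≤ n * c :=
    (tendsto_natCast_atTop_atTop.atTop_mul_const hc).eventually_ge_atTop K
  filter_upwards [eventually_gt_atTop 0, hlarge (2 * L ^ 2) (pow_pos hδ 2),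
    hlarge (Real.log 2) hδ] with n hn hvar htwo τ ⟨i₀, hi₀⟩
  have hpos : 0 < y i₀ := (Real.exp_pos _).trans hi₀
  obtain ⟨p, hp, hlow, hp'⟩ := exists_le_tiltedMean hy hpos (c := τ + 2 * δ)
    (by linarith [(Real.lt_log_iff_exp_lt hpos).2 hi₀])
  -- At `p = 1` both exponents vanish, so it does not matter how far above `τ` the mean lies.
  have hexponent : (1 - p) * (τ + η) = (1 - p) * (tiltedMean y p + δ) := by
    rcases hp' with rfl | hmean
    · ring
    · rw [hmean, hδη]
      ring
  refine ⟨p, hp, ?_⟩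
  rw [hexponent]
  refine le_excess_tensorPow_of_two_mul_le hy hpos hL hn hδ hvar hp (Real.exp_pos _) ?_
  calc 2 * Real.exp (n * τ) = Real.exp (Real.log 2 + n * τ) := by
        rw [Real.exp_add, Real.exp_log two_pos]
    _ ≤ Real.exp (n * (tiltedMean y p - δ)) := by
        gcongr
        nlinarith [mul_le_mul_of_nonneg_left hlow n.cast_nonneg]

end LowerBound

section Comparison

lemma excess_tensorPow_smul_le {d : ℕ} {x : Fin d → ℝ} (hx : ∀ i, 0 ≤ x i) (η τ : ℝ) {p : ℝ}
    (hp : 1 ≤ p) (n : ℕ) :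
    excess (tensorPow (Real.exp (-η) • x) n) (Real.exp (n * τ)) ≤
      Real.exp (-η) ^ n * (∑ i, x i ^ p) ^ n * Real.exp (n * ((1 - p) * (τ + η))) := by
  have hscaled : ∀ i, 0 ≤ (Real.exp (-η) • x) i := fun i => mul_nonneg (Real.exp_pos _).le (hx i)
  have hsum : ∑ i, (Real.exp (-η) • x) i ^ p = Real.exp (-η * p) * ∑ i, x i ^ p := by
    simp only [Pi.smul_apply, smul_eq_mul, Real.mul_rpow (Real.exp_pos _).le (hx _), mul_sum,
      Real.exp_mul]
  calc excess (tensorPow (Real.exp (-η) • x) n) (Real.exp (n * τ))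
      ≤ (∑ a, tensorPow (Real.exp (-η) • x) n a ^ p) * Real.exp (n * τ) ^ (1 - p) :=
        excess_le_sum_rpow_mul (tensorPow_nonneg hscaled n) hp (Real.exp_pos _)
    _ = Real.exp (-η) ^ n * (∑ i, x i ^ p) ^ n * Real.exp (n * ((1 - p) * (τ + η))) := by
        rw [sum_tensorPow_rpow hscaled, hsum, mul_pow, ← Real.exp_mul, ← Real.exp_nat_mul,
          ← Real.exp_nat_mul, mul_right_comm, mul_right_comm _ _ (Real.exp _), ← Real.exp_add,
          ← Real.exp_add]
        ring_nf

theorem eventually_excess_tensorPow_le {e d : ℕ} {x : Fin e → ℝ} {y : Fin d → ℝ}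
    (hx : ∀ i, 0 ≤ x i) (hy : ∀ i, 0 ≤ y i)
    (hpow : ∀ p : ℝ, 1 ≤ p → ∑ i, x i ^ p ≤ ∑ i, y i ^ p) {c : ℝ} (hc : 0 < c) (hc1 : c < 1) :
    ∀ᶠ n : ℕ in atTop, ∀ t, 0 < t →
      excess (tensorPow (c • x) n) t ≤ excess (tensorPow y n) t := by
  obtain ⟨η, rfl⟩ : ∃ η, Real.exp (-η) = c := ⟨-Real.log c, by rw [neg_neg, Real.exp_log hc]⟩
  have hη : 0 < η := by simpa using hc1
  have hcx : ∀ i, 0 ≤ (Real.exp (-η) • x) i := fun i => mul_nonneg hc.le (hx i)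
  have hdecay : ∀ᶠ n : ℕ in atTop, Real.exp (-η) ^ n ≤ 1 / 4 :=
    (tendsto_pow_atTop_nhds_zero_of_lt_one hc.le hc1).eventually_le_const (by norm_num)
  filter_upwards [eventually_ne_atTop 0, hdecay,
    eventually_exists_le_excess_tensorPow hy hη] with n hn hdecay_n hlower t ht
  have hn' : (n : ℝ) ≠ 0 := Nat.cast_ne_zero.2 hn
  obtain ⟨τ, rfl⟩ : ∃ τ, Real.exp (n * τ) = t :=
    ⟨Real.log t / n, by rw [mul_div_cancel₀ _ hn', Real.exp_log ht]⟩
  by_cases hτ : ∃ i, Real.exp (τ + η) < y i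
  · obtain ⟨p, hp, hle⟩ := hlower τ hτ
    calc excess (tensorPow (Real.exp (-η) • x) n) (Real.exp (n * τ))
        ≤ Real.exp (-η) ^ n * (∑ i, x i ^ p) ^ n * Real.exp (n * ((1 - p) * (τ + η))) :=
          excess_tensorPow_smul_le hx η τ hp n
      _ ≤ 1 / 4 * (∑ i, y i ^ p) ^ n * Real.exp (n * ((1 - p) * (τ + η))) := by
          have hxp : 0 ≤ ∑ i, x i ^ p := sum_nonneg fun i _ => Real.rpow_nonneg (hx i) p
          gcongr
          exact hpow p hp
      _ ≤ excess (tensorPow y n) (Real.exp (n * τ)) := hle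
  · push Not at hτ
    have hbound (i : Fin e) : (Real.exp (-η) • x) i ≤ Real.exp τ := by
      calc Real.exp (-η) * x i ≤ Real.exp (-η) * Real.exp (τ + η) := by
            gcongr
            exact le_of_forall_sum_rpow_le hx hy hpow (Real.exp_pos _) hτ i
        _ = Real.exp τ := by rw [← Real.exp_add]; ring_nf
    rw [excess_eq_zero_of_le fun a =>
      (tensorPow_le_pow hcx hbound n a).trans_eq (Real.exp_nat_mul τ n).symm]
    exact excess_nonneg _ _

end Comparison

section Filling

variable {e d D : ℕ}

lemma tensorPow_le_apply {x : Fin d → ℝ} (hx : ∀ i, x i ∈ Set.Icc 0 1) {n : ℕ}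
    (a : Fin n → Fin d) (j : Fin n) : tensorPow x n a ≤ x (a j) := by
  rw [tensorPow, ← mul_prod_erase univ _ (mem_univ j)]
  exact mul_le_of_le_one_right (hx _).1
    (prod_le_one (fun k _ => (hx (a k)).1) fun k _ => (hx (a k)).2)

lemma excess_tensorPow_append {x : Fin e → ℝ} {v : Fin D → ℝ}
    (hxv : ∀ i, Fin.append x v i ∈ Set.Icc 0 1) {t : ℝ} (hv : ∀ i, v i ≤ t) (n : ℕ) :
    excess (tensorPow (Fin.append x v) n) t = excess (tensorPow x n) t := by
  refine (Fintype.sum_of_injective (fun (a : Fin n → Fin e) j => Fin.castAdd D (a j))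
    (fun a b hab => funext fun j => Fin.castAdd_injective e D (congrFun hab j)) _ _
    (fun a ha => ?_) fun a => by simp [tensorPow]).symm
  have hcases (k : Fin (e + D)) : (∃ i, Fin.castAdd D i = k) ∨ ∃ i, k = Fin.natAdd e i :=
    k.addCases (fun i => .inl ⟨i, rfl⟩) fun i => .inr ⟨i, rfl⟩
  obtain ⟨j, i, hji⟩ : ∃ j i, a j = Fin.natAdd e i := by
    by_contra! hne
    choose b hb using fun j => (hcases (a j)).resolve_right (not_exists.2 (hne j))
    exact ha ⟨b, funext hb⟩
  rw [posPart_eq_zero, sub_nonpos]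
  calc tensorPow (Fin.append x v) n a ≤ Fin.append x v (a j) := tensorPow_le_apply hxv a j
    _ = v i := by rw [hji, Fin.append_right]
    _ ≤ t := hv i

lemma append_const_mem_P {x : Fin e → ℝ} (hx : ∀ i, 0 ≤ x i) {s : ℝ} (hs : 0 ≤ s)
    (hsum : ∑ i, x i + D * s = 1) : Fin.append x (fun _ : Fin D => s) ∈ P (e + D) :=
  ⟨Fin.addCases (by simpa using hx) (by simp [hs]), by simpa [Fin.sum_univ_add] using hsum⟩

theorem majorized_tensorPow_append {x : Fin e → ℝ} (hx : ∀ i, 0 ≤ x i) {s : ℝ} (hs : 0 < s)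
    (hsum : ∑ i, x i + D * s = 1) {y : Fin d → ℝ} (hy : y ∈ P d) {n : ℕ} (hn : n ≠ 0)
    (hD : d ^ n ≤ D) (h : ∀ t, 0 < t → excess (tensorPow x n) t ≤ excess (tensorPow y n) t) :
    Majorized (tensorPow (Fin.append x fun _ : Fin D => s) n) (tensorPow y n) := by
  set z := Fin.append x fun _ : Fin D => s
  have hz : z ∈ P (e + D) := append_const_mem_P hx hs.le hsum
  have hhigh {t : ℝ} (hst : s ≤ t) : excess (tensorPow z n) t = excess (tensorPow x n) t :=
    excess_tensorPow_append (mem_Icc_of_mem_stdSimplex hz) (fun _ => hst) n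
  have hlevel : excess (tensorPow z n) s ≤
      ∑ a, tensorPow y n a - Fintype.card (Fin n → Fin d) * s := by
    have hmass : ∑ i, x i ≤ 1 := by linarith [mul_nonneg D.cast_nonneg hs.le]
    have hcard : (d : ℝ) ^ n ≤ D := by exact_mod_cast hD
    calc excess (tensorPow z n) s ≤ (∑ i, x i) ^ n := by
          rw [hhigh le_rfl, ← sum_tensorPow]
          exact excess_le_sum (tensorPow_nonneg hx n) hs.le
      _ ≤ ∑ i, x i := pow_le_of_le_one (sum_nonneg fun i _ => hx i) hmass hn
      _ = 1 - D * s := by linarith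
      _ ≤ 1 - d ^ n * s := by gcongr
      _ = ∑ a, tensorPow y n a - Fintype.card (Fin n → Fin d) * s := by
          simp [sum_tensorPow, hy.2]
  refine majorized_of_excess_le (tensorPow_nonneg hy.1 n) fun t ht => ?_
  rcases le_total t s with hts | hst
  · refine excess_le_excess_of_le_of_excess_le (tensorPow_nonneg hz.1 n) ?_ hs hlevel ht hts
    rw [sum_tensorPow, sum_tensorPow, hz.2, hy.2]
  · exact (hhigh hst).trans_le (h t (hs.trans_le hst))

end Filling

section Approximation

lemma pad_fin {d : ℕ} (x : Fin d → ℝ) (i : Fin d) : pad x i = x i :=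
  dif_pos i.2

lemma pad_eq_zero_of_le {d : ℕ} (x : Fin d → ℝ) {i : ℕ} (hi : d ≤ i) : pad x i = 0 :=
  dif_neg hi.not_gt

lemma norm_pad {d : ℕ} (x : Fin d → ℝ) : ‖pad x‖ = ∑ i, |x i| := by
  rw [lp.norm_eq_tsum_rpow (by norm_num), tsum_eq_sum (s := range d), Finset.sum_range]
  · simp [pad_fin]
  · intro i hi
    simp [pad_eq_zero_of_le x (by simpa using hi)]

lemma pad_append_sub_pad {d D : ℕ} (x y : Fin d → ℝ) (v : Fin D → ℝ) :
    pad (Fin.append x v) - pad y = pad (Fin.append (x - y) v) := by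
  ext i
  rw [lp.coeFn_sub, Pi.sub_apply]
  rcases lt_or_ge i (d + D) with hlt | hge
  · obtain ⟨j, rfl⟩ : ∃ j : Fin (d + D), j = i := ⟨⟨i, hlt⟩, rfl⟩
    rw [pad_fin, pad_fin]
    induction j using Fin.addCases with
    | left j => rw [Fin.val_castAdd, pad_fin, Fin.append_left, Fin.append_left, Pi.sub_apply]
    | right j =>
      rw [Fin.val_natAdd, pad_eq_zero_of_le y (Nat.le_add_right d j), Fin.append_right,
        Fin.append_right, sub_zero]
  · rw [pad_eq_zero_of_le _ hge, pad_eq_zero_of_le _ hge,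
      pad_eq_zero_of_le y (le_of_add_le_left hge), sub_zero]

theorem exists_mem_MFin_norm_sub_pad_le {e d : ℕ} {x : Fin e → ℝ} {y : Fin d → ℝ} (hx : x ∈ P e)
    (hy : y ∈ P d) (hpow : ∀ p : ℝ, 1 ≤ p → ∑ i, x i ^ p ≤ ∑ i, y i ^ p) {ε : ℝ} (hε : 0 < ε)
    (hε1 : ε < 1) : ∃ u ∈ MFin y, ‖u - pad x‖ ≤ 2 * ε := by
  have hd : d ≠ 0 := by
    rintro rfl
    simpa using hy.2
  obtain ⟨n, hn, hexcess⟩ := ((eventually_ne_atTop 0).and (eventually_excess_tensorPow_le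
    hx.1 hy.1 hpow (sub_pos.2 hε1) (sub_lt_self 1 hε))).exists
  set D := d ^ n
  set s := ε / D
  have hDpos : (0 : ℝ) < D := by positivity
  have hs : 0 < s := div_pos hε hDpos
  have hDs : D * s = ε := mul_div_cancel₀ ε hDpos.ne'
  have hx' : ∀ i, 0 ≤ ((1 - ε) • x) i := fun i => mul_nonneg (sub_pos.2 hε1).le (hx.1 i)
  have hsum : ∑ i, ((1 - ε) • x) i + D * s = 1 := by
    simp [← mul_sum, hx.2, hDs]
  refine ⟨pad (Fin.append ((1 - ε) • x) fun _ : Fin D => s), Set.mem_iUnion.2 ⟨e + D, _,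
    ⟨append_const_mem_P hx' hs.le hsum, n, Nat.one_le_iff_ne_zero.2 hn,
      majorized_tensorPow_append hx' hs hsum hy hn le_rfl hexcess⟩, rfl⟩, le_of_eq ?_⟩
  rw [pad_append_sub_pad, norm_pad, Fin.sum_univ_add]
  have hshrink (i : Fin e) : |((1 - ε) • x - x) i| = ε * x i := by
    rw [← abs_of_nonneg (mul_nonneg hε.le (hx.1 i)), ← abs_neg]
    simp [sub_mul]
  simp only [Fin.append_left, Fin.append_right, hshrink, ← mul_sum, hx.2, abs_of_pos hs,
    sum_const, card_univ, Fintype.card_fin, nsmul_eq_mul, hDs]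
  ring

end Approximation

end Catalysis

theorem mainTheorem3_general {e d : ℕ} {x : Fin e → ℝ} {y : Fin d → ℝ} (hx : x ∈ Catalysis.P e)
    (hy : y ∈ Catalysis.P d)
    (hN : ∀ p : ℝ, 1 ≤ p → Catalysis.N p x ≤ Catalysis.N p y) :
    Catalysis.pad x ∈ closure (Catalysis.MFin y) := by
  have hpow (p : ℝ) (hp : 1 ≤ p) : ∑ i, x i ^ p ≤ ∑ i, y i ^ p := by
    have hp0 : p ≠ 0 := (zero_lt_one.trans_le hp).ne'
    rw [← Catalysis.N_eq_sum_rpow hx.1 hp0, ← Catalysis.N_eq_sum_rpow hy.1 hp0]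
    exact hN p hp
  refine Metric.mem_closure_iff.2 fun r hr => ?_
  obtain ⟨ε, hε, hεr⟩ := exists_between (lt_min one_pos (half_pos hr))
  rw [lt_min_iff] at hεr
  obtain ⟨u, hu, hux⟩ := Catalysis.exists_mem_MFin_norm_sub_pad_le hx hy hpow hε hεr.1
  exact ⟨u, hu, by rw [dist_comm, dist_eq_norm]; linarith⟩

theorem mainTheorem3 (d : ℕ) (x y : Fin d → ℝ) (hx : x ∈ Catalysis.P d) (hy : y ∈ Catalysis.P d)
    (hN : ∀ p : ℝ, 1 ≤ p → Catalysis.N p x ≤ Catalysis.N p y) :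
    ∃ u : ℕ → Catalysis.L1,
      (∀ n, u n ∈ Catalysis.MFin y) ∧ Tendsto u atTop (𝓝 (Catalysis.pad x)) :=
  mem_closure_iff_seq_limit.1 (mainTheorem3_general hx hy hN)
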